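/- Let $A$ be a self-adjoint operator, bounded or semi-bounded from below, on a complex Hilbert space $\mathcal H$, with quadratic form $\mathfrak a$ (the closure of $(u,v)\mapsto\langle Au,v\rangle$ on $\mathrm{Dom}(A)$). Let $m=\min\sigma(A)$ and $\Vert u\Vert_{\mathfrak a}=(\mathfrak a[u,u]-(m-1)\langle u,u\rangle)^{1/2}$ for $u\in\mathrm{Dom}(\mathfrak a)$. Let $a<b$ be real numbers in the resolvent set $\rho(A)$ such that $\sigma_{\mathrm{ess}}(A)\cap[a,b]=\varnothing$. Put $\Delta=[a,b]$ and let $\mathcal L(\Delta)$ be the (finite-dimensional) span of the eigenspaces $\ker(A-\lambda)$, $\lambda\in\sigma(A)\cap\Delta$. Let $(\mathcal L_n)_{n\in\mathbb N}$ be a sequence of finite-dimensional subspaces of $\mathrm{Dom}(\mathfrak a)$ such that for every $u\in\mathrm{Dom}(\mathfrak a)$ there are $u_n\in\mathcal L_n$ with $\Vert u-u_n\Vert_{\mathfrak a}\to0$. Let $\mathcal L_n(\Delta)$ be the span of all $u\in\mathcal L_n$ for which there is $\mu\in\Delta$ with $\mathfrak a[u,v]=\mu\langle u,v\rangle$ for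 all $v\in\mathcal L_n$ (the Galerkin eigenvectors with eigenvalues in $\Delta$). For subspaces $\mathcal L,\mathcal M$ of $\mathcal H$ put $\delta(\mathcal L,\mathcal M)=\sup\{\mathrm{dist}(u,\mathcal M): u\in\mathcal L,\ \Vert u\Vert=1\}$, with $\delta(\{0\},\mathcal M)=0$. Spectral pollution is said to occur in $\Delta$ for $(\mathcal L_n)$ if $\delta(\mathcal L_n(\Delta),\mathcal L(\Delta))$ does not converge to $0$. Then spectral pollution occurs in $\Delta$ for $(\mathcal L_n)$ if and only if there is a subsequence $(n_j)_{j\in\mathbb N}$ such that $\dim\mathcal L_{n_j}(\Delta)>\dim\mathcal L(\Delta)$ for all $j\in\mathbb N$. -/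

import Mathlib

open Filter Topology

noncomputable section

namespace SpectralPollution

variable {H : Type*} [NormedAddCommGroup H] [InnerProductSpace ℂ H]

/-! ### Spectral theory of an unbounded operator -/

/-- The operator `A` is semi-bounded from below: `c ‖u‖² ≤ ⟨A u, u⟩` on the domain of `A`. -/
def SemiBounded (A : H →ₗ.[ℂ] H) : Prop :=
  ∃ c : ℝ, ∀ u : A.domain, c * ‖(u : H)‖ ^ 2 ≤ (inner ℂ (u : H) (A u)).re

/-- `ρ(A)`: the `ζ` such that `A - ζ` is a bijection of `Dom A` onto `H` with a bounded
(everywhere defined) inverse `R`. -/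
def resolventSet (A : H →ₗ.[ℂ] H) : Set ℂ :=
  {ζ | ∃ R : H →L[ℂ] H,
    (∀ u : A.domain, R (A u - ζ • (u : H)) = u) ∧
    ∀ v : H, ∃ h : R v ∈ A.domain, A ⟨R v, h⟩ - ζ • R v = v}

/-- `σ(A)`. -/
def spectrum (A : H →ₗ.[ℂ] H) : Set ℂ := (resolventSet A)ᶜ

/-- `ker (A - ζ)`, as a subspace of `H`. -/
def eigenspace (A : H →ₗ.[ℂ] H) (ζ : ℂ) : Submodule ℂ H :=
  (LinearMap.ker (A.toFun - ζ • A.domain.subtype)).map A.domain.subtype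

/-- `σ_dis(A)`: the isolated points of `σ(A)` that are eigenvalues of finite multiplicity. -/
def discreteSpectrum (A : H →ₗ.[ℂ] H) : Set ℂ :=
  {ζ | ζ ∈ spectrum A ∧ ζ ∉ closure (spectrum A \ {ζ}) ∧
    eigenspace A ζ ≠ ⊥ ∧ FiniteDimensional ℂ (eigenspace A ζ)}

/-- `σ_ess(A) = σ(A) \ σ_dis(A)`. -/
def essentialSpectrum (A : H →ₗ.[ℂ] H) : Set ℂ := spectrum A \ discreteSpectrum A

/-- `m = min σ(A)`. -/
def spectralMin (A : H →ₗ.[ℂ] H) : ℝ := sInf {x : ℝ | (x : ℂ) ∈ spectrum A}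

/-- `𝓛(Δ)` for `Δ = [a, b]`: the eigenspace associated with `σ(A) ∩ Δ`. -/
def spectralSubspace (A : H →ₗ.[ℂ] H) (a b : ℝ) : Submodule ℂ H :=
  ⨆ x ∈ {x : ℝ | x ∈ Set.Icc a b ∧ (x : ℂ) ∈ spectrum A}, eigenspace A (x : ℂ)

/-! ### The quadratic form of a semi-bounded self-adjoint operator

It is the closure of the form `(u, v) ↦ ⟨A u, v⟩` on `Dom A`. -/

/-- The sequence `s` in `Dom A` is form-convergent to `u`: it converges to `u` in `H` and
`⟨A (s k - s l), s k - s l⟩ → 0` as `k, l → ∞`. -/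
def FormApprox (A : H →ₗ.[ℂ] H) (s : ℕ → A.domain) (u : H) : Prop :=
  Tendsto (fun k => (s k : H)) atTop (𝓝 u) ∧
  Tendsto (fun p : ℕ × ℕ => inner ℂ ((s p.1 - s p.2 : A.domain) : H) (A (s p.1 - s p.2)))
    atTop (𝓝 0)

/-- `Dom(𝔞)`. -/
def formDomain (A : H →ₗ.[ℂ] H) : Set H := {u | ∃ s, FormApprox A s u}

/-- `z` is a limit of `⟨A s_k, t_k⟩` for some sequences form-convergent to `u` and `v`. -/
def IsFormValue (A : H →ₗ.[ℂ] H) (u v : H) (z : ℂ) : Prop :=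
  ∃ s t : ℕ → A.domain, FormApprox A s u ∧ FormApprox A t v ∧
    Tendsto (fun k => inner ℂ (t k : H) (A (s k))) atTop (𝓝 z)

/-- `𝔞[u, v]`, linear in `u` and conjugate-linear in `v`: the limit of `⟨A s_k, t_k⟩` along
sequences form-convergent to `u` and `v` (see `tendsto_form`). -/
def form (A : H →ₗ.[ℂ] H) (u v : H) : ℂ := Classical.epsilon (IsFormValue A u v)

/-! The next two facts show that `form` is well defined. -/

section WellDefined

attribute [local instance] InnerProductSpace.Core.toSeminormedAddCommGroup

theorem core_limits {V : Type*} [AddCommGroup V] [Module ℂ V] (c : PreInnerProductSpace.Core ℂ V)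
    (B : V → V → ℂ) (hB : ∀ x y, c.inner x y = B x y) :
    (∀ s t : ℕ → V,
      Tendsto (fun p : ℕ × ℕ => (B (s p.1 - s p.2) (s p.1 - s p.2)).re) atTop (𝓝 0) →
      Tendsto (fun p : ℕ × ℕ => (B (t p.1 - t p.2) (t p.1 - t p.2)).re) atTop (𝓝 0) →
      ∃ z, Tendsto (fun k => B (s k) (t k)) atTop (𝓝 z)) ∧
    (∀ w t : ℕ → V,
      Tendsto (fun p : ℕ × ℕ => (B (w p.1 - w p.2) (w p.1 - w p.2)).re) atTop (𝓝 0) →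
      (∀ v, Tendsto (fun k => B (w k) v) atTop (𝓝 0)) →
      Tendsto (fun p : ℕ × ℕ => (B (t p.1 - t p.2) (t p.1 - t p.2)).re) atTop (𝓝 0) →
      Tendsto (fun k => B (w k) (t k)) atTop (𝓝 0)) := by
  let : InnerProductSpace ℂ V := InnerProductSpace.ofCore c
  have hin : ∀ x y : V, B x y = inner ℂ x y := fun x y => (hB x y).symm
  have key : ∀ s : ℕ → V,
      Tendsto (fun p : ℕ × ℕ => (B (s p.1 - s p.2) (s p.1 - s p.2)).re) atTop (𝓝 0) →
      ∃ S : UniformSpace.Completion V,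
        Tendsto (fun k => (s k : UniformSpace.Completion V)) atTop (𝓝 S) := by
    intro s hs
    apply cauchySeq_tendsto_of_complete
    refine (UniformSpace.Completion.uniformContinuous_coe V).comp_cauchySeq (u := s) ?_
    rw [cauchySeq_iff_tendsto_dist_atTop_0]
    have h2 := (Real.continuous_sqrt.tendsto 0).comp hs
    rw [Real.sqrt_zero] at h2
    refine h2.congr fun p => ?_
    rw [dist_eq_norm, norm_eq_sqrt_re_inner (𝕜 := ℂ)]
    simp [hin]
  have hc : ∀ x y : V, B x y =
      inner ℂ (x : UniformSpace.Completion V) (y : UniformSpace.Completion V) := fun x y => by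
    rw [hin, UniformSpace.Completion.inner_coe]
  refine ⟨fun s t hs ht => ?_, fun w t hw hwv ht => ?_⟩
  · obtain ⟨S, hS⟩ := key s hs
    obtain ⟨T, hT⟩ := key t ht
    exact ⟨inner ℂ S T, by simpa only [hc] using hS.inner hT⟩
  · obtain ⟨W, hW⟩ := key w hw
    obtain ⟨T, hT⟩ := key t ht
    have hz : ∀ v : V, inner ℂ W (v : UniformSpace.Completion V) = 0 := fun v =>
      tendsto_nhds_unique (by simpa only [hc] using hW.inner tendsto_const_nhds) (hwv v)
    have hT0 : inner ℂ W T = 0 := by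
      have h1 : Tendsto (fun k => inner ℂ W (t k : UniformSpace.Completion V)) atTop
          (𝓝 (inner ℂ W T)) := tendsto_const_nhds.inner hT
      simp only [hz] at h1
      exact (tendsto_nhds_unique h1 tendsto_const_nhds)
    rw [← hT0]
    simpa only [hc] using hW.inner hT

end WellDefined

/-- Along form-convergent sequences, `⟨A s_k, t_k⟩` tends to `𝔞[u, v]`. -/
theorem tendsto_form {A : H →ₗ.[ℂ] H} (hA : A.IsFormalAdjoint A) (hsb : SemiBounded A)
    {u v : H} {s t : ℕ → A.domain} (hs : FormApprox A s u) (ht : FormApprox A t v) :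
    Tendsto (fun k => inner ℂ (t k : H) (A (s k))) atTop (𝓝 (form A u v)) := by
  obtain ⟨c, hc⟩ := hsb
  let B : A.domain → A.domain → ℂ := fun x y => inner ℂ (x : H) (A y) - c * inner ℂ (x : H) (y : H)
  have hsym : ∀ x y : A.domain, inner ℂ (A x) (y : H) = inner ℂ (x : H) (A y) := fun x y => hA x y
  let C : PreInnerProductSpace.Core ℂ A.domain :=
    { inner := B
      conj_inner_symm := fun x y => by simp [B, hsym]
      re_inner_nonneg := fun x => by
        have := hc x
        have h2 : inner ℂ (x : H) (x : H) = ((‖(x : H)‖ ^ 2 : ℝ) : ℂ) := by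
          rw [inner_self_eq_norm_sq_to_K]; norm_cast
        simp only [B, h2, RCLike.re_to_complex, Complex.sub_re, Complex.re_ofReal_mul,
          Complex.ofReal_re]
        linarith
      add_left := fun x y z => by simp [B]; ring
      smul_left := fun x y r => by simp [B]; ring }
  obtain ⟨lim1, lim2⟩ := core_limits C B fun _ _ => rfl
  have hB : ∀ {s : ℕ → A.domain} {u : H}, FormApprox A s u →
      Tendsto (fun p : ℕ × ℕ => (B (s p.1 - s p.2) (s p.1 - s p.2)).re) atTop (𝓝 0) := by
    intro s u h
    have h1 : Tendsto (fun p : ℕ × ℕ => ((s p.1 : H) - (s p.2 : H))) atTop (𝓝 (u - u)) := by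
      rw [← prod_atTop_atTop_eq]
      exact (h.1.comp tendsto_fst).sub (h.1.comp tendsto_snd)
    have h2 := h.2.sub ((h1.inner (𝕜 := ℂ) h1).const_mul (c : ℂ))
    have h3 := (Complex.continuous_re.tendsto _).comp h2
    simpa [B, Function.comp_def] using h3
  have hsub : ∀ {s s' : ℕ → A.domain} {u u' : H}, FormApprox A s u → FormApprox A s' u' →
      Tendsto (fun p : ℕ × ℕ => (B ((s p.1 - s' p.1) - (s p.2 - s' p.2))
        ((s p.1 - s' p.1) - (s p.2 - s' p.2))).re) atTop (𝓝 0) := by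
    intro s s' u u' h h'
    refine squeeze_zero (fun p => C.re_inner_nonneg _) (g := fun p =>
      2 * (B (s p.1 - s p.2) (s p.1 - s p.2)).re + 2 * (B (s' p.1 - s' p.2) (s' p.1 - s' p.2)).re)
      (fun p => ?_) (by simpa using ((hB h).const_mul 2).add ((hB h').const_mul 2))
    have h0 := C.re_inner_nonneg ((s p.1 - s p.2) + (s' p.1 - s' p.2))
    have e1 : (s p.1 - s' p.1) - (s p.2 - s' p.2) = (s p.1 - s p.2) - (s' p.1 - s' p.2) := by abel
    rw [e1]
    generalize s p.1 - s p.2 = x at *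
    generalize s' p.1 - s' p.2 = y at *
    change 0 ≤ (B (x + y) (x + y)).re at h0
    have e2 : B (x + y) (x + y) + B (x - y) (x - y) = 2 * B x x + 2 * B y y := by
      simp only [B, A.map_add, A.map_sub, Submodule.coe_add, Submodule.coe_sub, inner_add_left,
        inner_add_right, inner_sub_left, inner_sub_right]
      ring
    have e3 := congrArg Complex.re e2
    simp at e3
    linarith
  -- differences of two sequences approximating the same vector are negligible
  have hneg : ∀ {s s' t : ℕ → A.domain} {u v : H}, FormApprox A s u → FormApprox A s' u →
      FormApprox A t v → Tendsto (fun k => B (s k - s' k) (t k)) atTop (𝓝 0) := by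
    intro s s' t u v h h' h''
    refine lim2 (fun k => s k - s' k) t (hsub h h') (fun w => ?_) (hB h'')
    have h1 : Tendsto (fun k => (s k : H) - (s' k : H)) atTop (𝓝 0) := by
      simpa using h.1.sub h'.1
    have h2 := (h1.inner (𝕜 := ℂ) (tendsto_const_nhds (x := A w))).sub
      ((h1.inner (𝕜 := ℂ) (tendsto_const_nhds (x := (w : H)))).const_mul (c : ℂ))
    simpa [B, inner_sub_left] using h2
  have hBin : ∀ {s t : ℕ → A.domain} {u v : H} {z : ℂ}, FormApprox A s u → FormApprox A t v →
      (Tendsto (fun k => B (t k) (s k)) atTop (𝓝 z) ↔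
        Tendsto (fun k => inner ℂ (t k : H) (A (s k))) atTop (𝓝 (z + c * inner ℂ v u))) := by
    intro s t u v z h h'
    have h1 := (h'.1.inner (𝕜 := ℂ) h.1).const_mul (c : ℂ)
    constructor
    · intro h2
      exact (h2.add h1).congr fun k => by simp [B]
    · intro h2
      have := h2.sub h1
      rw [add_sub_cancel_right] at this
      exact this
  have huniq : ∀ {s t s' t' : ℕ → A.domain} {z : ℂ}, FormApprox A s u → FormApprox A t v →
      FormApprox A s' u → FormApprox A t' v →
      Tendsto (fun k => B (t k) (s k)) atTop (𝓝 z) →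
      Tendsto (fun k => B (t' k) (s' k)) atTop (𝓝 z) := by
    intro s t s' t' z h1 h2 h3 h4 hz
    have d1 := hneg h4 h2 h3
    have d2 := (Complex.continuous_conj.tendsto 0).comp (hneg h3 h1 h2)
    have d := (hz.add d1).add d2
    simp only [map_zero, add_zero] at d
    refine d.congr fun k => ?_
    have e : (starRingEnd ℂ) (B (s' k - s k) (t k)) = B (t k) (s' k - s k) :=
      C.conj_inner_symm _ _
    rw [Function.comp_apply, e]
    simp only [B, A.map_sub, Submodule.coe_sub, inner_sub_left, inner_sub_right]
    ring
  obtain ⟨z, hz⟩ := lim1 t s (hB ht) (hB hs)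
  have hex : ∃ z, IsFormValue A u v z := ⟨_, s, t, hs, ht, (hBin hs ht).1 hz⟩
  obtain ⟨s', t', hs', ht', h'⟩ := Classical.epsilon_spec hex
  have h2 := (hBin hs' ht').1 (huniq hs ht hs' ht' hz)
  have : form A u v = z + c * inner ℂ v u := tendsto_nhds_unique h' h2
  rw [this]
  exact (hBin hs ht).1 hz

/-- `‖u‖_𝔞 = (𝔞[u, u] - (m - 1)⟨u, u⟩)^{1/2}`. -/
def formNorm (A : H →ₗ.[ℂ] H) (u : H) : ℝ :=
  Real.sqrt ((form A u u).re - (spectralMin A - 1) * ‖u‖ ^ 2)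

/-! ### Galerkin approximation -/

/-- The vectors `u ∈ L` with `𝔞[u, v] = μ ⟨u, v⟩` for all `v ∈ L`. -/
def galerkinVectors (A : H →ₗ.[ℂ] H) (L : Submodule ℂ H) (μ : ℝ) : Set H :=
  {u | u ∈ L ∧ ∀ v ∈ L, form A u v = μ * inner ℂ v u}

/-- The Galerkin eigenvalues `σ(A, L)`. -/
def galerkinSpectrum (A : H →ₗ.[ℂ] H) (L : Submodule ℂ H) : Set ℝ :=
  {μ | ∃ u ∈ galerkinVectors A L μ, u ≠ 0}

/-- `L(Δ)` for `Δ = [a, b]`: the eigenspace corresponding to `σ(A, L) ∩ Δ`. -/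
def galerkinSubspace (A : H →ₗ.[ℂ] H) (L : Submodule ℂ H) (a b : ℝ) : Submodule ℂ H :=
  Submodule.span ℂ (⋃ μ ∈ galerkinSpectrum A L ∩ Set.Icc a b, galerkinVectors A L μ)

/-- `(L n)` is an admissible sequence of trial spaces for `A`: they are finite-dimensional
subspaces of the form domain, and every `u ∈ Dom(𝔞)` is a limit, in the norm `‖·‖_𝔞`, of some
`v n ∈ L n`. -/
structure IsTrialSequence (A : H →ₗ.[ℂ] H) (L : ℕ → Submodule ℂ H) : Prop where
  finiteDimensional : ∀ n, FiniteDimensional ℂ (L n)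
  subset_formDomain : ∀ n, (L n : Set H) ⊆ formDomain A
  approx : ∀ u ∈ formDomain A, ∃ v : ℕ → H, (∀ n, v n ∈ L n) ∧
    Tendsto (fun n => formNorm A (u - v n)) atTop (𝓝 0)

/-- The gap `δ(L, M) = sup {dist(u, M) : u ∈ L, ‖u‖ = 1}`, equal to `0` if `L = {0}`. -/
def gap (L M : Submodule ℂ H) : ℝ :=
  sSup ((fun u => Metric.infDist u (M : Set H)) '' {u | u ∈ L ∧ ‖u‖ = 1})

/-- Spectral pollution occurs in `[a, b]` for `(L n)`: `δ(L_n(Δ), 𝓛(Δ))` does not tend to `0`. -/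
def PollutionOccurs (A : H →ₗ.[ℂ] H) (L : ℕ → Submodule ℂ H) (a b : ℝ) : Prop :=
  ¬ Tendsto (fun n => gap (galerkinSubspace A (L n) a b) (spectralSubspace A a b)) atTop (𝓝 0)

end SpectralPollution

end

/-!
The Galerkin eigenspaces `L_n(Δ)` never miss a part of the spectral subspace `𝓛(Δ)`: every
`u ∈ 𝓛(Δ)` satisfies `dist(u, L_n(Δ)) → 0` (`tendsto_infDist_galerkinSubspace`). Pollution can thus
only come from superfluous vectors in `L_n(Δ)`, and these are detected by the dimension.

* Let `A u = l u` with `l ∈ Δ`; as the endpoints of `Δ` are in the resolvent set, `l` is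
  interior. Expand the projection `p` of `u` onto `L_n`, taken in the inner product `𝔞 - (m - 1)`, in an
  orthonormal basis `e i` of Galerkin eigenvectors. The identity
  `(μ i - l) ⟨p, e i⟩ = (l - (m - 1)) ⟨u - p, e i⟩` bounds the components of `p` with `μ i ∉ Δ` by
  those of `u - p`, and `‖u - p‖` is at most the distance of `u` to `L_n` in the norm `‖·‖_𝔞`
  (`infDist_galerkinSubspace_le`). This needs `m` to be a lower bound of `A`
  (`isLowerBound_spectralMin`), so that `𝔞 - (m - 1)` is positive definite; no spectral theorem for
  unbounded operators is involved.
* If `dim L_n(Δ) ≤ dim 𝓛(Δ)`, comparing the Hilbert–Schmidt norms of `(1 - P) Q` and `(1 - Q) P` for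
  the orthogonal projections `P` onto `𝓛(Δ)` and `Q` onto `L_n(Δ)` bounds the gap
  `δ(L_n(Δ), 𝓛(Δ))` by the distances to `L_n(Δ)` of an orthonormal basis of `𝓛(Δ)`
  (`gap_le_sqrt_sum`). So there is no pollution if this holds for all large `n`.
* If `dim L_n(Δ) > dim 𝓛(Δ)`, some unit vector of `L_n(Δ)` is orthogonal to `𝓛(Δ)`, and the gap is
  at least `1` (`one_le_gap`).

The comparison of dimensions is meaningful because `𝓛(Δ)` is finite-dimensional
(`finiteDimensional_spectralSubspace`).
-/

noncomputable section

namespace SpectralPollution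

variable {H : Type*} [NormedAddCommGroup H] [InnerProductSpace ℂ H]

/-! ### The bottom of the spectrum -/

theorem isFormalAdjoint_self [CompleteSpace H] {A : H →ₗ.[ℂ] H} (hA : IsSelfAdjoint A) :
    A.IsFormalAdjoint A := by
  have h := LinearPMap.adjoint_isFormalAdjoint hA.dense_domain
  rwa [LinearPMap.isSelfAdjoint_def.1 hA] at h

/-- A self-adjoint operator is maximal: its domain contains every `y` for which `⟨A x, y⟩ = ⟨x, w⟩`
for some `w` and all `x`, and then `A y = w`. -/
theorem exists_mem_domain_of_forall_inner [CompleteSpace H] {A : H →ₗ.[ℂ] H}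
    (hA : IsSelfAdjoint A) {y w : H}
    (h : ∀ x : A.domain, inner ℂ w (x : H) = inner ℂ y (A x)) :
    ∃ hy : y ∈ A.domain, A ⟨y, hy⟩ = w := by
  have key : ∃ hy : y ∈ A.adjoint.domain, A.adjoint ⟨y, hy⟩ = w :=
    ⟨LinearPMap.mem_adjoint_domain_of_exists y ⟨w, h⟩,
      LinearPMap.adjoint_apply_eq hA.dense_domain _ h⟩
  rwa [LinearPMap.isSelfAdjoint_def.1 hA] at key

/-- `c` is a lower bound of `A`: this is the inequality in `SemiBounded` with `c` fixed. -/
def IsLowerBound (A : H →ₗ.[ℂ] H) (c : ℝ) : Prop :=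
  ∀ u : A.domain, c * ‖(u : H)‖ ^ 2 ≤ (inner ℂ (u : H) (A u)).re

/-- A self-adjoint operator that is bounded below has a bounded inverse: its range is closed because
the operator is closed, and dense because a vector orthogonal to the range is in the kernel. -/
theorem mem_resolventSet_of_lt [CompleteSpace H] {A : H →ₗ.[ℂ] H} (hA : IsSelfAdjoint A) {c z : ℝ}
    (hc : IsLowerBound A c) (hz : z < c) : (z : ℂ) ∈ resolventSet A := by
  have hsym := isFormalAdjoint_self hA
  set T : A.domain →ₗ[ℂ] H := A.toFun - (z : ℂ) • A.domain.subtype with hT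
  have hTa : ∀ u : A.domain, T u = A u - (z : ℂ) • (u : H) := fun u => rfl
  have hd : 0 < c - z := sub_pos.2 hz
  have hlow : ∀ u : A.domain, (c - z) * ‖(u : H)‖ ≤ ‖T u‖ := by
    intro u
    have h1 : (c - z) * ‖(u : H)‖ ^ 2 ≤ (inner ℂ (u : H) (T u)).re := by
      have := hc u
      rw [hTa, inner_sub_right, inner_smul_right, inner_self_eq_norm_sq_to_K]
      have e : ((z : ℂ) * ((‖(u : H)‖ : ℂ)) ^ 2).re = z * ‖(u : H)‖ ^ 2 := by
        rw [← Complex.ofReal_pow, Complex.re_ofReal_mul, Complex.ofReal_re]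
      rw [Complex.sub_re]
      erw [e]
      linarith
    have h2 : (inner ℂ (u : H) (T u)).re ≤ ‖(u : H)‖ * ‖T u‖ :=
      (Complex.re_le_norm _).trans (norm_inner_le_norm _ _)
    rcases (norm_nonneg (u : H)).eq_or_lt with h0 | h0
    · rw [← h0, mul_zero]; exact norm_nonneg _
    · nlinarith
  have hinj : Function.Injective T := by
    rw [injective_iff_map_eq_zero]
    intro u hu
    have := hlow u
    rw [hu, norm_zero] at this
    have h0 : ‖(u : H)‖ = 0 := le_antisymm (by nlinarith) (norm_nonneg _)
    exact Subtype.ext (norm_eq_zero.1 h0)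
  have hclosed : IsClosed (LinearMap.range T : Set H) := by
    refine isClosed_of_closure_subset fun y hy => ?_
    obtain ⟨s, hs, hlim⟩ := mem_closure_iff_seq_limit.1 hy
    choose x hx using hs
    have hcau : CauchySeq fun n => ((x n : A.domain) : H) := by
      rw [Metric.cauchySeq_iff]
      intro ε hε
      obtain ⟨N, hN⟩ := Metric.cauchySeq_iff.1 hlim.cauchySeq ((c - z) * ε) (by positivity)
      refine ⟨N, fun m hm n hn => ?_⟩
      have h1 := hlow (x m - x n)
      have h2 := hN m hm n hn
      rw [dist_eq_norm, ← hx, ← hx, ← map_sub] at h2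
      rw [dist_eq_norm]
      have h3 : (c - z) * ‖(x m : H) - x n‖ < (c - z) * ε := h1.trans_lt h2
      exact lt_of_mul_lt_mul_left h3 hd.le
    obtain ⟨u, hu⟩ := cauchySeq_tendsto_of_complete hcau
    have hAx : Tendsto (fun n => A (x n)) atTop (𝓝 (y + (z : ℂ) • u)) := by
      refine (hlim.add (hu.const_smul (z : ℂ))).congr fun n => ?_
      rw [← hx, hTa, sub_add_cancel]
    obtain ⟨hmem, hval⟩ := exists_mem_domain_of_forall_inner hA (y := u) (w := y + (z : ℂ) • u)
      fun w => tendsto_nhds_unique (hAx.inner tendsto_const_nhds)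
        ((hu.inner tendsto_const_nhds).congr fun n => (hsym _ _).symm)
    exact ⟨⟨u, hmem⟩, by rw [hTa, hval]; simp⟩
  have hsurj : LinearMap.range T = ⊤ := by
    have : CompleteSpace (LinearMap.range T) := hclosed.completeSpace_coe
    rw [← Submodule.orthogonal_eq_bot_iff, Submodule.eq_bot_iff]
    intro v hv
    have hv' : ∀ x : A.domain, inner ℂ v (A x - (z : ℂ) • (x : H)) = 0 := fun x =>
      (Submodule.mem_orthogonal' _ _).1 hv _ ⟨x, rfl⟩
    obtain ⟨hmem, hval⟩ := exists_mem_domain_of_forall_inner hA (y := v) (w := (z : ℂ) • v)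
      fun x => by
        have := hv' x
        rw [inner_sub_right, sub_eq_zero] at this
        rw [this, inner_smul_left, inner_smul_right, Complex.conj_ofReal]
    have h0 : T ⟨v, hmem⟩ = 0 := by rw [hTa, hval, sub_self]
    exact congrArg Subtype.val (hinj (h0.trans (map_zero T).symm))
  let e : A.domain ≃ₗ[ℂ] H := LinearEquiv.ofBijective T ⟨hinj, LinearMap.range_eq_top.1 hsurj⟩
  have hTe : ∀ v, T (e.symm v) = v := fun v => e.apply_symm_apply v
  refine ⟨(A.domain.subtype ∘ₗ e.symm.toLinearMap).mkContinuous (c - z)⁻¹ fun v => ?_,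
    fun u => ?_, fun v => ⟨(e.symm v).2, hTe v⟩⟩
  · have h1 := hlow (e.symm v)
    rw [hTe] at h1
    rw [inv_mul_eq_div, le_div_iff₀' hd]
    exact h1
  · exact congrArg Subtype.val (e.symm_apply_apply u)

/-- If `c` is a lower bound of `A` and `A - c` has a bounded inverse `R`, then `c` is not the best
lower bound. The form `q` of `A - c` is nonnegative, and expanding `0 ≤ q (u - t • R u)` for a
suitable `t > 0` gives `q u ≥ ‖u‖² / (‖R‖ + 1)`. -/
theorem exists_isLowerBound_gt {A : H →ₗ.[ℂ] H} (hsym : A.IsFormalAdjoint A) {c : ℝ}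
    (hc : IsLowerBound A c) (hρ : (c : ℂ) ∈ resolventSet A) : ∃ c' > c, IsLowerBound A c' := by
  obtain ⟨R, -, hR⟩ := hρ
  set K : ℝ := ‖R‖ + 1 with hK
  have hK0 : 0 < K := by positivity
  refine ⟨c + K⁻¹, by simpa using hK0, fun u => ?_⟩
  obtain ⟨hr, hAr⟩ := hR (u : H)
  set r : A.domain := ⟨R u, hr⟩ with hr_def
  have hAr' : A r = (u : H) + (c : ℂ) • (r : H) := by rw [← hAr, sub_add_cancel]
  have hru : inner ℂ (r : H) (A u) =
      inner ℂ (u : H) (u : H) + c * inner ℂ (r : H) (u : H) := by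
    rw [← hsym r u, hAr', inner_add_left, inner_smul_left, Complex.conj_ofReal]
  have hq := hc (u - (K⁻¹ : ℂ) • r)
  have hbound : (inner ℂ (r : H) (u : H)).re ≤ K * ‖(u : H)‖ ^ 2 := by
    have h1 : (inner ℂ (r : H) (u : H)).re ≤ ‖(r : H)‖ * ‖(u : H)‖ :=
      (Complex.re_le_norm _).trans (norm_inner_le_norm _ _)
    have h2 : ‖(r : H)‖ ≤ ‖R‖ * ‖(u : H)‖ := R.le_opNorm _
    nlinarith [norm_nonneg (u : H)]
  have hre : ∀ x : H, (‖x‖ ^ 2 : ℝ) = (inner ℂ x x).re := fun x => by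
    rw [norm_sq_eq_re_inner (𝕜 := ℂ)]; rfl
  have hcomm : (inner ℂ (u : H) (r : H)).re = (inner ℂ (r : H) (u : H)).re := by
    rw [← inner_conj_symm, Complex.conj_re]
  rw [hre] at hq hbound ⊢
  have hKc : (K⁻¹ : ℂ) = ((K⁻¹ : ℝ) : ℂ) := by push_cast; rfl
  simp only [A.map_sub, A.map_smul, Submodule.coe_sub, Submodule.coe_smul, inner_sub_left,
    inner_sub_right, inner_smul_left, inner_smul_right, hru, hAr', hKc, Complex.conj_ofReal,
    inner_add_right, Complex.sub_re, Complex.add_re, Complex.re_ofReal_mul, hcomm] at hq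
  generalize (inner ℂ (u : H) (A u)).re = x at *
  generalize (inner ℂ (u : H) (u : H)).re = y at *
  generalize (inner ℂ (r : H) (u : H)).re = w at *
  generalize (inner ℂ (r : H) (r : H)).re = v at *
  have h3 : K⁻¹ * (K⁻¹ * w) ≤ K⁻¹ * y := by
    have := mul_le_mul_of_nonneg_left hbound (by positivity : 0 ≤ K⁻¹)
    rw [inv_mul_cancel_left₀ hK0.ne'] at this
    exact mul_le_mul_of_nonneg_left this (by positivity)
  nlinarith

theorem IsLowerBound.mono {A : H →ₗ.[ℂ] H} {c d : ℝ} (hc : IsLowerBound A c) (hd : d ≤ c) :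
    IsLowerBound A d := fun u =>
  (mul_le_mul_of_nonneg_right hd (by positivity)).trans (hc u)

/-- The bottom `m` of the spectrum is a lower bound of `A`: the best lower bound, if there is one,
is a point of the spectrum. -/
theorem isLowerBound_spectralMin [CompleteSpace H] {A : H →ₗ.[ℂ] H} (hA : IsSelfAdjoint A)
    (hsb : SemiBounded A) : IsLowerBound A (spectralMin A) := by
  obtain ⟨c, hc⟩ := hsb
  by_cases hbdd : BddAbove {d : ℝ | IsLowerBound A d}
  · have hsup : IsLowerBound A (sSup {d : ℝ | IsLowerBound A d}) := by
      intro u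
      rcases (sq_nonneg ‖(u : H)‖).eq_or_lt with h0 | h0
      · have := hc u
        rw [← h0, mul_zero] at this ⊢
        exact this
      · rw [← le_div_iff₀ h0]
        exact csSup_le ⟨c, hc⟩ fun d hd => (le_div_iff₀ h0).2 (hd u)
    refine hsup.mono (csInf_le ⟨c, fun x hx => ?_⟩ fun hρ => ?_)
    · by_contra hlt
      exact hx (mem_resolventSet_of_lt hA hc (not_le.1 hlt))
    · obtain ⟨d, hd, hd'⟩ := exists_isLowerBound_gt (isFormalAdjoint_self hA) hsup hρ
      exact (le_csSup hbdd hd').not_gt hd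
  -- this case occurs only for the zero space, where `spectralMin A` is a junk value
  · obtain ⟨d, hd, hlt⟩ := not_bddAbove_iff.1 hbdd (spectralMin A)
    exact IsLowerBound.mono hd hlt.le

/-! ### The closed quadratic form as a Hermitian form on its domain -/

theorem FormApprox.const (A : H →ₗ.[ℂ] H) (u : A.domain) : FormApprox A (fun _ => u) (u : H) :=
  ⟨tendsto_const_nhds, by simp⟩

theorem FormApprox.smul {A : H →ₗ.[ℂ] H} {s : ℕ → A.domain} {u : H} (hs : FormApprox A s u)
    (z : ℂ) : FormApprox A (fun k => z • s k) (z • u) := by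
  refine ⟨by simpa using hs.1.const_smul z, ?_⟩
  have h := hs.2.const_mul ((starRingEnd ℂ) z * z)
  rw [mul_zero] at h
  refine h.congr fun p => ?_
  rw [← smul_sub, A.map_smul, Submodule.coe_smul, inner_smul_left, inner_smul_right, mul_assoc]

/-- The quadratic form of `A - c ≥ 0` satisfies `q (x + y) ≤ 2 q x + 2 q y`, so form-convergence is
preserved by sums. -/
theorem FormApprox.add {A : H →ₗ.[ℂ] H} (hA : A.IsFormalAdjoint A) (hsb : SemiBounded A)
    {s t : ℕ → A.domain} {u v : H} (hs : FormApprox A s u) (ht : FormApprox A t v) :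
    FormApprox A (fun k => s k + t k) (u + v) := by
  obtain ⟨c, hc⟩ := hsb
  refine ⟨by simpa using hs.1.add ht.1, ?_⟩
  -- `⟨A x, x⟩` is real, and `⟨A x, x⟩ - c ‖x‖²` is nonnegative
  have him : ∀ x : A.domain, (inner ℂ (x : H) (A x)).im = 0 := fun x => by
    rw [← Complex.conj_eq_iff_im, inner_conj_symm, hA]
  have hdiff : ∀ {s : ℕ → A.domain} {u : H}, FormApprox A s u →
      Tendsto (fun p : ℕ × ℕ => ‖((s p.1 - s p.2 : A.domain) : H)‖ ^ 2) atTop (𝓝 0) := by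
    intro s u h
    have h1 : Tendsto (fun p : ℕ × ℕ => ((s p.1 - s p.2 : A.domain) : H)) atTop (𝓝 (u - u)) := by
      rw [← prod_atTop_atTop_eq]
      exact (h.1.comp tendsto_fst).sub (h.1.comp tendsto_snd)
    simpa using h1.norm.pow 2
  have hre : ∀ {s : ℕ → A.domain} {u : H}, FormApprox A s u →
      Tendsto (fun p : ℕ × ℕ => (inner ℂ ((s p.1 - s p.2 : A.domain) : H)
        (A (s p.1 - s p.2))).re) atTop (𝓝 0) := fun h =>
    (Complex.continuous_re.tendsto 0).comp h.2
  have hsum : Tendsto (fun p : ℕ × ℕ => ‖(((s p.1 + t p.1) - (s p.2 + t p.2) : A.domain) : H)‖ ^ 2)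
      atTop (𝓝 0) := by
    have h1 : Tendsto (fun p : ℕ × ℕ => (((s p.1 + t p.1) - (s p.2 + t p.2) : A.domain) : H))
        atTop (𝓝 ((u + v) - (u + v))) := by
      rw [← prod_atTop_atTop_eq]
      exact ((hs.1.add ht.1).comp tendsto_fst).sub ((hs.1.add ht.1).comp tendsto_snd)
    simpa using h1.norm.pow 2
  have hq : Tendsto (fun p : ℕ × ℕ =>
      (inner ℂ (((s p.1 + t p.1) - (s p.2 + t p.2) : A.domain) : H)
        (A ((s p.1 + t p.1) - (s p.2 + t p.2)))).re -
        c * ‖(((s p.1 + t p.1) - (s p.2 + t p.2) : A.domain) : H)‖ ^ 2) atTop (𝓝 0) := by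
    have hlim := (((hre hs).sub ((hdiff hs).const_mul c)).const_mul 2).add
      (((hre ht).sub ((hdiff ht).const_mul c)).const_mul 2)
    simp only [mul_zero, sub_zero, add_zero] at hlim
    refine squeeze_zero (fun p => sub_nonneg.2 (hc _)) (fun p => ?_) hlim
    have e1 : (s p.1 + t p.1) - (s p.2 + t p.2) = (s p.1 - s p.2) + (t p.1 - t p.2) := by abel
    rw [e1]
    generalize s p.1 - s p.2 = x
    generalize t p.1 - t p.2 = y
    have h0 := hc (x - y)
    have e2 := parallelogram_law_with_norm ℂ (x : H) (y : H)
    have e3 : inner ℂ ((x + y : A.domain) : H) (A (x + y)) +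
        inner ℂ ((x - y : A.domain) : H) (A (x - y)) =
        2 * inner ℂ (x : H) (A x) + 2 * inner ℂ (y : H) (A y) := by
      simp only [A.map_add, A.map_sub, Submodule.coe_add, Submodule.coe_sub, inner_add_left,
        inner_add_right, inner_sub_left, inner_sub_right]
      ring
    have e4 := congrArg Complex.re e3
    simp only [Complex.add_re, Complex.mul_re, Complex.re_ofNat, Complex.im_ofNat, zero_mul,
      sub_zero] at e4
    rw [Submodule.coe_sub] at h0
    rw [Submodule.coe_sub] at e4
    rw [Submodule.coe_add] at e4 ⊢
    have e5 : c * ‖(x : H) + y‖ ^ 2 + c * ‖(x : H) - y‖ ^ 2 =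
        2 * (c * ‖(x : H)‖ ^ 2) + 2 * (c * ‖(y : H)‖ ^ 2) := by
      linear_combination c * e2
    linarith
  have h := hq.add (hsum.const_mul c)
  simp only [sub_add_cancel, mul_zero, add_zero] at h
  have h' := (Complex.continuous_ofReal.tendsto 0).comp h
  rw [Complex.ofReal_zero] at h'
  refine h'.congr fun p => ?_
  rw [Function.comp_apply]
  exact Complex.ext (Complex.ofReal_re _) ((Complex.ofReal_im _).trans (him _).symm)

/-- `Dom(𝔞)` as a subspace of `H`. -/
def formSubmodule {A : H →ₗ.[ℂ] H} (hA : A.IsFormalAdjoint A) (hsb : SemiBounded A) :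
    Submodule ℂ H where
  carrier := formDomain A
  add_mem' := fun ⟨_, hs⟩ ⟨_, ht⟩ => ⟨_, hs.add hA hsb ht⟩
  zero_mem' := ⟨_, FormApprox.const A 0⟩
  smul_mem' := fun z _ ⟨_, hs⟩ => ⟨_, hs.smul z⟩

section Form

variable {A : H →ₗ.[ℂ] H} (hA : A.IsFormalAdjoint A) (hsb : SemiBounded A)

theorem domain_le_formSubmodule : A.domain ≤ formSubmodule hA hsb := fun u hu =>
  ⟨_, FormApprox.const A ⟨u, hu⟩⟩

theorem form_conj {u v : H} (hu : u ∈ formSubmodule hA hsb) (hv : v ∈ formSubmodule hA hsb) :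
    (starRingEnd ℂ) (form A u v) = form A v u := by
  obtain ⟨_, hs⟩ := hu
  obtain ⟨_, ht⟩ := hv
  refine tendsto_nhds_unique
    ((Complex.continuous_conj.tendsto _).comp (tendsto_form hA hsb hs ht))
    ((tendsto_form hA hsb ht hs).congr fun k => ?_)
  rw [Function.comp_apply, inner_conj_symm, hA]

theorem form_add_left {u u' v : H} (hu : u ∈ formSubmodule hA hsb)
    (hu' : u' ∈ formSubmodule hA hsb) (hv : v ∈ formSubmodule hA hsb) :
    form A (u + u') v = form A u v + form A u' v := by
  obtain ⟨s, hs⟩ := hu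
  obtain ⟨s', hs'⟩ := hu'
  obtain ⟨t, ht⟩ := hv
  refine tendsto_nhds_unique (tendsto_form hA hsb (hs.add hA hsb hs') ht)
    (((tendsto_form hA hsb hs ht).add (tendsto_form hA hsb hs' ht)).congr fun k => ?_)
  rw [A.map_add, inner_add_right]

theorem form_smul_left {u v : H} (z : ℂ) (hu : u ∈ formSubmodule hA hsb)
    (hv : v ∈ formSubmodule hA hsb) : form A (z • u) v = z * form A u v := by
  obtain ⟨s, hs⟩ := hu
  obtain ⟨t, ht⟩ := hv
  refine tendsto_nhds_unique (tendsto_form hA hsb (hs.smul z) ht)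
    (((tendsto_form hA hsb hs ht).const_mul z).congr fun k => ?_)
  rw [A.map_smul, inner_smul_right]

theorem form_add_right {u v v' : H} (hu : u ∈ formSubmodule hA hsb)
    (hv : v ∈ formSubmodule hA hsb) (hv' : v' ∈ formSubmodule hA hsb) :
    form A u (v + v') = form A u v + form A u v' := by
  rw [← form_conj hA hsb (add_mem hv hv') hu, form_add_left hA hsb hv hv' hu, map_add,
    form_conj hA hsb hv hu, form_conj hA hsb hv' hu]

theorem form_smul_right {u v : H} (z : ℂ) (hu : u ∈ formSubmodule hA hsb)
    (hv : v ∈ formSubmodule hA hsb) : form A u (z • v) = (starRingEnd ℂ) z * form A u v := by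
  rw [← form_conj hA hsb (Submodule.smul_mem _ z hv) hu, form_smul_left hA hsb z hv hu, map_mul,
    form_conj hA hsb hv hu]

theorem form_of_mem_domain (u : A.domain) {v : H} (hv : v ∈ formSubmodule hA hsb) :
    form A u v = inner ℂ v (A u) := by
  obtain ⟨t, ht⟩ := hv
  exact tendsto_nhds_unique (tendsto_form hA hsb (FormApprox.const A u) ht)
    (ht.1.inner tendsto_const_nhds)

theorem IsLowerBound.le_form {c : ℝ} (hc : IsLowerBound A c) {u : H}
    (hu : u ∈ formSubmodule hA hsb) : c * ‖u‖ ^ 2 ≤ (form A u u).re := by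
  obtain ⟨s, hs⟩ := hu
  exact le_of_tendsto_of_tendsto' ((hs.1.norm.pow 2).const_mul c)
    ((Complex.continuous_re.tendsto _).comp (tendsto_form hA hsb hs hs)) fun k => hc (s k)

/-- The form as a sesquilinear map on its domain, conjugate-linear in the first argument. -/
def formMap : formSubmodule hA hsb →ₗ⋆[ℂ] formSubmodule hA hsb →ₗ[ℂ] ℂ :=
  LinearMap.mk₂'ₛₗ (starRingEnd ℂ) (RingHom.id ℂ) (fun v u => form A (u : H) (v : H))
    (fun v v' u => form_add_right hA hsb u.2 v.2 v'.2)
    (fun z v u => form_smul_right hA hsb z u.2 v.2)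
    (fun v u u' => form_add_left hA hsb u.2 u'.2 v.2)
    (fun z v u => form_smul_left hA hsb z u.2 v.2)

@[simp]
theorem formMap_apply (v u : formSubmodule hA hsb) :
    formMap hA hsb v u = form A (u : H) (v : H) := rfl

end Form

/-! ### Galerkin eigenvectors near an eigenvector -/

/-- On a finite-dimensional space, every sesquilinear form is represented by a linear map. -/
theorem exists_linearMap_inner_eq {E : Type*} [NormedAddCommGroup E] [InnerProductSpace ℂ E]
    [FiniteDimensional ℂ E] (B : E →ₗ⋆[ℂ] E →ₗ[ℂ] ℂ) :
    ∃ T : E →ₗ[ℂ] E, ∀ v u, inner ℂ v (T u) = B v u := by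
  let b := stdOrthonormalBasis ℂ E
  refine ⟨∑ i, (B (b i)).smulRight (b i), fun v u => ?_⟩
  conv_rhs => rw [← b.sum_repr' v]
  simp [LinearMap.sum_apply, inner_conj_symm, mul_comm]

theorem norm_sq_sum_smul {ι : Type*} {e : ι → H} (he : Orthonormal ℂ e) (s : Finset ι)
    (z : ι → ℂ) : ‖∑ i ∈ s, z i • e i‖ ^ 2 = ∑ i ∈ s, ‖z i‖ ^ 2 := by
  rw [norm_sq_eq_re_inner (𝕜 := ℂ), he.inner_sum, map_sum]
  exact Finset.sum_congr rfl fun i _ => by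
    rw [Complex.conj_mul', ← Complex.ofReal_pow]; exact Complex.ofReal_re _

section Galerkin

variable {A : H →ₗ.[ℂ] H} (hA : A.IsFormalAdjoint A) (hsb : SemiBounded A)

theorem form_sum_smul_left {ι : Type*} (s : Finset ι) (z : ι → ℂ) (e : ι → H) {v : H}
    (he : ∀ i, e i ∈ formSubmodule hA hsb) (hv : v ∈ formSubmodule hA hsb) :
    form A (∑ i ∈ s, z i • e i) v = ∑ i ∈ s, z i * form A (e i) v := by
  have h := map_sum (formMap hA hsb ⟨v, hv⟩)
    (fun i => z i • (⟨e i, he i⟩ : formSubmodule hA hsb)) s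
  simpa only [map_smul, formMap_apply, smul_eq_mul, Submodule.coe_sum, Submodule.coe_smul] using h

/-- A finite-dimensional trial space has an orthonormal basis of Galerkin eigenvectors. -/
theorem exists_orthonormal_galerkinVectors {L : Submodule ℂ H} [FiniteDimensional ℂ L]
    (hL : L ≤ formSubmodule hA hsb) :
    ∃ (n : ℕ) (e : OrthonormalBasis (Fin n) ℂ L) (μ : Fin n → ℝ),
      ∀ i, (e i : H) ∈ galerkinVectors A L (μ i) := by
  let j := Submodule.inclusion hL
  obtain ⟨T, hT⟩ := exists_linearMap_inner_eq (((formMap hA hsb).comp j).compl₂ j)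
  have hT' : ∀ v u : L, inner ℂ v (T u) = form A (u : H) (v : H) := hT
  have hsymm : T.IsSymmetric := fun x y => by
    rw [← inner_conj_symm, hT', hT', form_conj hA hsb (hL x.2) (hL y.2)]
  refine ⟨_, hsymm.eigenvectorBasis rfl, hsymm.eigenvalues rfl, fun i => ⟨Subtype.coe_prop _, ?_⟩⟩
  intro v hv
  rw [← hT' ⟨v, hv⟩, hsymm.apply_eigenvectorBasis, inner_smul_right]
  rfl

/-- If `h` is orthogonal to `L` for the inner product `𝔞 - (m - 1)`, then adding an element of `L`
to `h` does not decrease the norm `‖·‖_𝔞`, which dominates the norm of `H`. -/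
theorem norm_le_formNorm_add (hm : IsLowerBound A (spectralMin A)) {L : Submodule ℂ H}
    (hL : L ≤ formSubmodule hA hsb) {h : H} (hh : h ∈ formSubmodule hA hsb)
    (horth : ∀ y ∈ L, form A h y = ((spectralMin A - 1 : ℝ) : ℂ) * inner ℂ y h) {y : H}
    (hy : y ∈ L) : ‖h‖ ≤ formNorm A (h + y) := by
  have hyF := hL hy
  have e1 : form A (h + y) (h + y) = form A h h + form A y y + (form A h y + form A y h) := by
    rw [form_add_left hA hsb hh hyF (add_mem hh hyF), form_add_right hA hsb hh hh hyF,
      form_add_right hA hsb hyF hh hyF]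
    ring
  have e2 : (form A h y + form A y h).re =
      (spectralMin A - 1) * (2 * (inner ℂ h y).re) := by
    rw [← form_conj hA hsb hh hyF, Complex.add_re, Complex.conj_re, horth y hy,
      Complex.re_ofReal_mul, ← inner_conj_symm, Complex.conj_re]
    ring
  have e3 : ‖h + y‖ ^ 2 = ‖h‖ ^ 2 + 2 * (inner ℂ h y).re + ‖y‖ ^ 2 := norm_add_sq (𝕜 := ℂ) h y
  have h1 := hm.le_form hA hsb hh
  have h2 := hm.le_form hA hsb hyF
  refine Real.le_sqrt_of_sq_le ?_
  rw [e1, Complex.add_re, Complex.add_re, e2, e3]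
  nlinarith [sq_nonneg ‖y‖]

/-- An eigenvector `u` of `A` whose eigenvalue is interior to `[a, b]` is as close to the Galerkin
eigenspace `L([a, b])` as it is to `L` in the norm `‖·‖_𝔞`, up to a constant independent of `L`.

With `z = m - 1` and an orthonormal basis of Galerkin eigenvectors `e i` for the eigenvalues `μ i`,
the best approximation of `u` in `L` is `p = ∑ (l - z) / (μ i - z) ⟨u, e i⟩ e i`. Its components
with `μ i ∉ [a, b]` are controlled by those of `u - p`, which are
`(μ i - l) / (μ i - z) ⟨u, e i⟩`. -/
theorem infDist_galerkinSubspace_le (hm : IsLowerBound A (spectralMin A)) {L : Submodule ℂ H}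
    [FiniteDimensional ℂ L] (hL : L ≤ formSubmodule hA hsb) {a b l d : ℝ} (hd : 0 < d)
    (hla : a + d ≤ l) (hlb : l + d ≤ b) {u : A.domain} (hu : A u = (l : ℂ) • (u : H)) {w : H}
    (hw : w ∈ L) :
    Metric.infDist (u : H) (galerkinSubspace A L a b : Set H) ≤
      (1 + |l - (spectralMin A - 1)| / d) * formNorm A (u - w) := by
  obtain ⟨n, e, μ, he⟩ := exists_orthonormal_galerkinVectors hA hsb hL
  set z : ℝ := spectralMin A - 1 with hz
  have heF : ∀ i, (e i : H) ∈ formSubmodule hA hsb := fun i => hL (e i).2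
  have huF : (u : H) ∈ formSubmodule hA hsb := domain_le_formSubmodule hA hsb u.2
  have hon : Orthonormal ℂ fun i => (e i : H) :=
    e.orthonormal.comp_linearIsometry L.subtypeₗᵢ
  have hβ : ∀ i, 0 < μ i - z := by
    intro i
    have h1 := hm.le_form hA hsb (heF i)
    rw [(he i).2 _ (e i).2, Complex.re_ofReal_mul, inner_self_eq_norm_sq_to_K, hon.1 i] at h1
    norm_num at h1
    linarith
  let γ : Fin n → ℂ := fun i => (((l - z) / (μ i - z) : ℝ) : ℂ) * inner ℂ (e i : H) (u : H)
  set p : H := ∑ i, γ i • (e i : H) with hp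
  have hpL : p ∈ L := Submodule.sum_mem _ fun i _ => Submodule.smul_mem _ _ (e i).2
  -- `p` is the orthogonal projection of `u` onto `L` for the inner product `𝔞 - z`
  have horth : ∀ y ∈ L, form A (u - p) y = (z : ℂ) * inner ℂ y ((u : H) - p) := by
    intro y hy
    have hyF := hL hy
    have hyu : inner ℂ y (u : H) = ∑ i, inner ℂ (e i : H) (u : H) * inner ℂ y (e i : H) := by
      have h1 : y = ∑ i, inner ℂ (e i : H) y • (e i : H) := by
        have := congrArg Subtype.val (e.sum_repr' ⟨y, hy⟩)
        simpa using this.symm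
      conv_lhs => rw [h1]
      simp [mul_comm]
    have h2 : form A (u - p) y = form A u y - form A p y := by
      rw [sub_eq_add_neg, ← neg_one_smul ℂ p,
        form_add_left hA hsb huF (Submodule.smul_mem _ _ (hL hpL)) hyF,
        form_smul_left hA hsb _ (hL hpL) hyF]
      ring
    rw [h2, form_of_mem_domain hA hsb u hyF, hu, hp, form_sum_smul_left hA hsb _ _ _ heF hyF,
      inner_smul_right, inner_sub_right, inner_sum, hyu, mul_sub, Finset.mul_sum, Finset.mul_sum,
      Finset.mul_sum, ← Finset.sum_sub_distrib, ← Finset.sum_sub_distrib]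
    refine Finset.sum_congr rfl fun i _ => ?_
    have hβ' : ((μ i : ℂ) - z) ≠ 0 := by
      rw [← Complex.ofReal_sub]; exact Complex.ofReal_ne_zero.2 (hβ i).ne'
    rw [(he i).2 y hy, inner_smul_right]
    simp only [γ]
    push_cast
    field_simp
    ring
  -- best approximation in `‖·‖_𝔞`, which dominates the norm of `H`
  have hA1 : ‖(u : H) - p‖ ≤ formNorm A (u - w) := by
    have := norm_le_formNorm_add hA hsb hm hL (sub_mem huF (hL hpL)) horth (sub_mem hpL hw)
    rwa [sub_add_sub_cancel] at this
  classical
  -- `x` is the part of `p` in the Galerkin eigenspace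
  let S : Finset (Fin n) := Finset.univ.filter fun i => μ i ∈ Set.Icc a b
  set x : H := ∑ i ∈ S, γ i • (e i : H) with hx
  have hxG : x ∈ galerkinSubspace A L a b := by
    refine Submodule.sum_mem _ fun i hi => Submodule.smul_mem _ _ (Submodule.subset_span ?_)
    exact Set.mem_biUnion (x := μ i)
      ⟨⟨_, he i, hon.ne_zero i⟩, (Finset.mem_filter.1 hi).2⟩ (he i)
  have hpx : p - x = ∑ i ∈ Sᶜ, γ i • (e i : H) := by
    rw [sub_eq_iff_eq_add, hp, hx, Finset.sum_compl_add_sum]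
  set K : ℝ := |l - z| / d with hK
  have hK0 : 0 ≤ K := by positivity
  have hcomp : ∀ i ∈ Sᶜ, ‖γ i‖ ≤ K * ‖inner ℂ (e i : H) ((u : H) - p)‖ := by
    intro i hi
    have h1 : inner ℂ (e i : H) ((u : H) - p) =
        (((μ i - l) / (μ i - z) : ℝ) : ℂ) * inner ℂ (e i : H) (u : H) := by
      rw [inner_sub_right, hp, hon.inner_right_fintype]
      have hβ' : ((μ i : ℂ) - z) ≠ 0 := by
        rw [← Complex.ofReal_sub]; exact Complex.ofReal_ne_zero.2 (hβ i).ne'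
      simp only [γ]
      push_cast
      field_simp
      ring
    have h2 : d ≤ |μ i - l| := by
      have : ¬ (a ≤ μ i ∧ μ i ≤ b) := by simpa [S] using hi
      by_contra hlt
      obtain ⟨h3, h4⟩ := abs_lt.1 (not_le.1 hlt)
      exact this ⟨by linarith, by linarith⟩
    rw [h1]
    simp only [γ]
    rw [norm_mul, norm_mul, ← mul_assoc]
    refine mul_le_mul_of_nonneg_right ?_ (norm_nonneg _)
    rw [Complex.norm_real, Complex.norm_real, Real.norm_eq_abs, Real.norm_eq_abs, abs_div, abs_div,
      hK, div_mul_div_comm, mul_comm d]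
    rw [div_le_div_iff₀ (abs_pos.2 (hβ i).ne') (mul_pos (abs_pos.2 (hβ i).ne') hd)]
    have := mul_le_mul_of_nonneg_left h2
      (mul_nonneg (abs_nonneg (l - z)) (abs_nonneg (μ i - z)))
    linarith
  have hA2 : ‖p - x‖ ≤ K * ‖(u : H) - p‖ := by
    refine le_of_sq_le_sq ?_ (by positivity)
    rw [hpx, norm_sq_sum_smul hon, mul_pow]
    calc _ ≤ ∑ i ∈ Sᶜ, K ^ 2 * ‖inner ℂ (e i : H) ((u : H) - p)‖ ^ 2 :=
          Finset.sum_le_sum fun i hi => by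
            rw [← mul_pow]; exact pow_le_pow_left₀ (norm_nonneg _) (hcomp i hi) 2
      _ ≤ K ^ 2 * ‖(u : H) - p‖ ^ 2 := by
          rw [← Finset.mul_sum]
          exact mul_le_mul_of_nonneg_left (hon.sum_inner_products_le _) (sq_nonneg _)
  calc Metric.infDist (u : H) (galerkinSubspace A L a b : Set H) ≤ dist (u : H) x :=
        Metric.infDist_le_dist_of_mem hxG
    _ ≤ ‖(u : H) - p‖ + ‖p - x‖ := by
        rw [dist_eq_norm]; exact norm_sub_le_norm_sub_add_norm_sub _ _ _
    _ ≤ (1 + K) * ‖(u : H) - p‖ := by linarith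
    _ ≤ (1 + K) * formNorm A (u - w) := by gcongr

end Galerkin

/-! ### The gap between finite-dimensional subspaces -/

theorem infDist_eq_norm_sub_starProjection (M : Submodule ℂ H) [M.HasOrthogonalProjection] (u : H) :
    Metric.infDist u (M : Set H) = ‖u - M.starProjection u‖ := by
  rw [M.starProjection_minimal, Metric.infDist_eq_iInf]
  simp only [dist_eq_norm]
  rfl

/-- The Pythagorean theorem for the distance to `M`, in terms of an orthonormal basis of `M`. -/
theorem sq_infDist {ι : Type*} [Fintype ι] {M : Submodule ℂ H} [FiniteDimensional ℂ M]
    (f : OrthonormalBasis ι ℂ M) (u : H) :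
    Metric.infDist u (M : Set H) ^ 2 = ‖u‖ ^ 2 - ∑ i, ‖inner ℂ (f i : H) u‖ ^ 2 := by
  have h1 := M.norm_sq_eq_add_norm_sq_starProjection u
  have h2 : ‖M.starProjection u‖ ^ 2 = ∑ i, ‖inner ℂ (f i : H) u‖ ^ 2 := by
    have h3 := f.sum_sq_norm_inner_right (M.orthogonalProjectionOnto u)
    simp only [Submodule.inner_orthogonalProjectionOnto_eq_of_mem_left] at h3
    exact h3.symm
  rw [infDist_eq_norm_sub_starProjection, h1, h2, Submodule.starProjection_orthogonal']
  exact (add_sub_cancel_left _ _).symm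

theorem gap_nonneg (G M : Submodule ℂ H) : 0 ≤ gap G M :=
  Real.sSup_nonneg (by rintro _ ⟨u, -, rfl⟩; exact Metric.infDist_nonneg)

/-- If `dim G ≤ dim M`, then `G` is close to `M` as soon as an orthonormal basis of `M` is close to
`G`. With `P` and `Q` the orthogonal projections onto `M` and `G`, the Hilbert–Schmidt norms satisfy
`‖(1 - P) Q‖² = dim G - tr (P Q) ≤ dim M - tr (P Q) = ‖(1 - Q) P‖²`. -/
theorem gap_le_sqrt_sum {ι : Type*} [Fintype ι] {G M : Submodule ℂ H} [FiniteDimensional ℂ G]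
    [FiniteDimensional ℂ M] (hGM : Module.finrank ℂ G ≤ Module.finrank ℂ M)
    (f : OrthonormalBasis ι ℂ M) :
    gap G M ≤ √(∑ i, Metric.infDist (f i : H) (G : Set H) ^ 2) := by
  let g := stdOrthonormalBasis ℂ G
  have hsum : ∑ k, Metric.infDist (g k : H) (M : Set H) ^ 2 ≤
      ∑ i, Metric.infDist (f i : H) (G : Set H) ^ 2 := by
    have hf : ∀ i, ‖(f i : H)‖ = 1 := fun i => f.norm_eq_one i
    have hg : ∀ k, ‖(g k : H)‖ = 1 := fun k => g.norm_eq_one k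
    simp only [sq_infDist f, sq_infDist g, hf, hg, Finset.sum_sub_distrib]
    rw [Finset.sum_comm]
    have hcomm : ∀ i k, ‖inner ℂ (g k : H) (f i : H)‖ = ‖inner ℂ (f i : H) (g k : H)‖ :=
      fun i k => norm_inner_symm _ _
    have hcard : Module.finrank ℂ M = Fintype.card ι := Module.finrank_eq_card_basis f.toBasis
    have h : (Module.finrank ℂ G : ℝ) ≤ Fintype.card ι := by exact_mod_cast hcard ▸ hGM
    simpa [hcomm] using h
  refine Real.sSup_le ?_ (Real.sqrt_nonneg _)
  rintro _ ⟨u, ⟨huG, hu⟩, rfl⟩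
  refine Real.le_sqrt_of_sq_le (le_trans ?_ hsum)
  have hu1 : u = ∑ k, inner ℂ (g k : H) u • (g k : H) := by
    have := congrArg Subtype.val (g.sum_repr' ⟨u, huG⟩)
    simpa using this.symm
  have hα : ∑ k, ‖inner ℂ (g k : H) u‖ ^ 2 = 1 := by
    have := g.sum_sq_norm_inner_right ⟨u, huG⟩
    simpa [hu] using this
  have hle : Metric.infDist u (M : Set H) ≤
      ∑ k, ‖inner ℂ (g k : H) u‖ * Metric.infDist (g k : H) (M : Set H) := by
    simp only [infDist_eq_norm_sub_starProjection]
    have : u - M.starProjection u =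
        ∑ k, inner ℂ (g k : H) u • ((g k : H) - M.starProjection (g k : H)) := by
      conv_lhs => rw [hu1]
      simp only [map_sum, map_smul, smul_sub, Finset.sum_sub_distrib]
    rw [this]
    exact norm_sum_le_of_le _ fun k _ => (norm_smul _ _).le
  calc Metric.infDist u (M : Set H) ^ 2
      ≤ (∑ k, ‖inner ℂ (g k : H) u‖ * Metric.infDist (g k : H) (M : Set H)) ^ 2 :=
        pow_le_pow_left₀ Metric.infDist_nonneg hle 2
    _ ≤ (∑ k, ‖inner ℂ (g k : H) u‖ ^ 2) * ∑ k, Metric.infDist (g k : H) (M : Set H) ^ 2 :=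
        Finset.sum_mul_sq_le_sq_mul_sq _ _ _
    _ = _ := by rw [hα, one_mul]

/-- If `dim M < dim G`, then `G` contains a unit vector orthogonal to `M`. -/
theorem one_le_gap {G M : Submodule ℂ H} [FiniteDimensional ℂ G] [FiniteDimensional ℂ M]
    (h : Module.finrank ℂ M < Module.finrank ℂ G) : 1 ≤ gap G M := by
  have hker := LinearMap.ker_ne_bot_of_finrank_lt
    (f := (M.orthogonalProjectionOnto : H →ₗ[ℂ] M) ∘ₗ G.subtype) h
  obtain ⟨x, hx, hx0⟩ := Submodule.exists_mem_ne_zero_of_ne_bot hker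
  have hPx : M.starProjection (x : H) = 0 := by
    rw [Submodule.starProjection_apply]
    exact congrArg Subtype.val (LinearMap.mem_ker.1 hx)
  have hx0' : ‖(x : H)‖ ≠ 0 := fun h0 => hx0 (Subtype.ext (norm_eq_zero.1 h0))
  set u : H := ((‖(x : H)‖⁻¹ : ℝ) : ℂ) • (x : H) with hu
  have hu1 : ‖u‖ = 1 := by
    rw [hu, norm_smul, Complex.norm_real, norm_inv, norm_norm, inv_mul_cancel₀ hx0']
  have hdist : Metric.infDist u (M : Set H) = 1 := by
    rw [infDist_eq_norm_sub_starProjection, hu, map_smul, hPx, smul_zero, sub_zero, ← hu, hu1]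
  rw [← hdist]
  refine le_csSup ⟨1, ?_⟩ ⟨u, ⟨Submodule.smul_mem _ _ x.2, hu1⟩, rfl⟩
  rintro _ ⟨v, ⟨-, hv⟩, rfl⟩
  rw [← hv, ← dist_zero_right]
  exact Metric.infDist_le_dist_of_mem M.zero_mem

/-! ### The spectral subspace -/

theorem mem_eigenspace {A : H →ₗ.[ℂ] H} {ζ : ℂ} {v : H} :
    v ∈ eigenspace A ζ ↔ ∃ u : A.domain, A u = ζ • (u : H) ∧ (u : H) = v := by
  simp only [eigenspace, Submodule.mem_map, LinearMap.mem_ker, LinearMap.sub_apply, sub_eq_zero]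
  rfl

theorem mem_discreteSpectrum {A : H →ₗ.[ℂ] H} {ζ : ℂ} (h : ζ ∉ essentialSpectrum A)
    (hζ : ζ ∈ spectrum A) : ζ ∈ discreteSpectrum A := by
  by_contra h'
  exact h ⟨hζ, h'⟩

/-- Spectral points in `[a, b]` are isolated eigenvalues, so they can only accumulate at a point `x`
of the resolvent set; but every eigenvalue `y` satisfies `|y - x| ‖R‖ ≥ 1` for `R = (A - x)⁻¹`. -/
theorem finite_spectrum_Icc {A : H →ₗ.[ℂ] H} {a b : ℝ}
    (hess : ∀ x ∈ Set.Icc a b, (x : ℂ) ∉ essentialSpectrum A) :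
    {x : ℝ | x ∈ Set.Icc a b ∧ (x : ℂ) ∈ spectrum A}.Finite := by
  by_contra hinf
  obtain ⟨x, hx, hacc⟩ := Set.Infinite.exists_accPt_of_subset_isCompact hinf isCompact_Icc
    fun y hy => hy.1
  rw [accPt_iff_frequently] at hacc
  by_cases hσ : (x : ℂ) ∈ spectrum A
  · refine (mem_discreteSpectrum (hess x hx) hσ).2.1 ?_
    rw [mem_closure_iff_frequently]
    refine Tendsto.frequently (Complex.continuous_ofReal.tendsto x) (hacc.mono ?_)
    exact fun y hy => ⟨hy.2.2, fun h => hy.1 (Complex.ofReal_injective h)⟩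
  · obtain ⟨R, hR, -⟩ := not_not.1 hσ
    have hev : ∀ᶠ y : ℝ in 𝓝 x, ‖((y : ℂ) - x)‖ * ‖R‖ < 1 := by
      have hcont : Continuous fun y : ℝ => ‖((y : ℂ) - x)‖ * ‖R‖ := by fun_prop
      exact hcont.continuousAt.eventually_lt continuousAt_const (by simp)
    obtain ⟨y, ⟨-, hy⟩, hlt⟩ := (hacc.and_eventually hev).exists
    obtain ⟨v, hv, hv0⟩ := Submodule.exists_mem_ne_zero_of_ne_bot
      (mem_discreteSpectrum (hess y hy.1) hy.2).2.2.1
    obtain ⟨u, hu, rfl⟩ := mem_eigenspace.1 hv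
    have h1 := hR u
    rw [hu, ← sub_smul, map_smul] at h1
    have h2 : ‖(u : H)‖ ≤ ‖((y : ℂ) - x)‖ * ‖R‖ * ‖(u : H)‖ := by
      conv_lhs => rw [← h1, norm_smul]
      rw [mul_assoc]
      exact mul_le_mul_of_nonneg_left (R.le_opNorm _) (norm_nonneg _)
    have h3 : 0 < ‖(u : H)‖ := norm_pos_iff.2 hv0
    nlinarith

theorem finiteDimensional_spectralSubspace {A : H →ₗ.[ℂ] H} {a b : ℝ}
    (hess : ∀ x ∈ Set.Icc a b, (x : ℂ) ∉ essentialSpectrum A) :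
    FiniteDimensional ℂ (spectralSubspace A a b) := by
  have := (finite_spectrum_Icc hess).to_subtype
  rw [spectralSubspace, iSup_subtype']
  have (x : {x : ℝ | x ∈ Set.Icc a b ∧ (x : ℂ) ∈ spectrum A}) :
      FiniteDimensional ℂ (eigenspace A ((x : ℝ) : ℂ)) :=
    (mem_discreteSpectrum (hess x x.2.1) x.2.2).2.2.2
  infer_instance

/-! ### Convergence of the Galerkin eigenspaces -/

/-- The vectors whose distance to `G n` tends to `0` form a subspace, so membership can be checked
on spanning subspaces. -/
theorem tendsto_infDist_of_mem_iSup {G : ℕ → Submodule ℂ H} [∀ n, FiniteDimensional ℂ (G n)]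
    {ι : Sort*} {E : ι → Submodule ℂ H}
    (hE : ∀ i, ∀ u ∈ E i, Tendsto (fun n => Metric.infDist u (G n : Set H)) atTop (𝓝 0)) {u : H}
    (hu : u ∈ ⨆ i, E i) : Tendsto (fun n => Metric.infDist u (G n : Set H)) atTop (𝓝 0) := by
  simp only [infDist_eq_norm_sub_starProjection, ← tendsto_zero_iff_norm_tendsto_zero] at hE ⊢
  refine Submodule.iSup_induction E
    (motive := fun v => Tendsto (fun n => v - (G n).starProjection v) atTop (𝓝 0)) hu hE (by simp)
    fun v w hv hw => ?_
  have h := hv.add hw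
  rw [add_zero] at h
  refine h.congr fun n => ?_
  rw [map_add]
  abel

theorem galerkinSubspace_le (A : H →ₗ.[ℂ] H) (L : Submodule ℂ H) (a b : ℝ) :
    galerkinSubspace A L a b ≤ L :=
  Submodule.span_le.2 (Set.iUnion₂_subset fun _ _ _ hu => hu.1)

/-- Every vector of the spectral subspace is a limit of vectors of the Galerkin eigenspaces. It is
enough to treat eigenvectors, whose eigenvalues are interior to `[a, b]`. -/
theorem tendsto_infDist_galerkinSubspace [CompleteSpace H] {A : H →ₗ.[ℂ] H} (hA : IsSelfAdjoint A)
    (hsb : SemiBounded A) {a b : ℝ} (ha : (a : ℂ) ∈ resolventSet A)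
    (hb : (b : ℂ) ∈ resolventSet A) {L : ℕ → Submodule ℂ H} (hL : IsTrialSequence A L) {u : H}
    (hu : u ∈ spectralSubspace A a b) :
    Tendsto (fun n => Metric.infDist u (galerkinSubspace A (L n) a b : Set H)) atTop (𝓝 0) := by
  have hfd := hL.finiteDimensional
  have (n : ℕ) : FiniteDimensional ℂ (galerkinSubspace A (L n) a b) :=
    Submodule.finiteDimensional_of_le (galerkinSubspace_le A (L n) a b)
  rw [spectralSubspace, iSup_subtype'] at hu
  refine tendsto_infDist_of_mem_iSup ?_ hu
  rintro ⟨x, hx, hσ⟩ v hv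
  obtain ⟨u, hu, rfl⟩ := mem_eigenspace.1 hv
  have hax : a < x := lt_of_le_of_ne hx.1 fun h => hσ (h ▸ ha)
  have hxb : x < b := lt_of_le_of_ne hx.2 fun h => hσ (h ▸ hb)
  have hsym := isFormalAdjoint_self hA
  obtain ⟨w, hwL, hw⟩ := hL.approx u (domain_le_formSubmodule hsym hsb u.2)
  have hlim := hw.const_mul (1 + |x - (spectralMin A - 1)| / min (x - a) (b - x))
  rw [mul_zero] at hlim
  exact squeeze_zero (fun n => Metric.infDist_nonneg)
    (fun n => infDist_galerkinSubspace_le hsym hsb (isLowerBound_spectralMin hA hsb)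
      (hL.subset_formDomain n) (lt_min (sub_pos.2 hax) (sub_pos.2 hxb))
      (by linarith [min_le_left (x - a) (b - x)]) (by linarith [min_le_right (x - a) (b - x)])
      hu (hwL n)) hlim

end SpectralPollution

end

theorem mainTheorem4 {H : Type*} [NormedAddCommGroup H] [InnerProductSpace ℂ H] [CompleteSpace H]
    (A : H →ₗ.[ℂ] H) (hA : IsSelfAdjoint A) (hsb : SpectralPollution.SemiBounded A)
    (a b : ℝ) (hab : a < b)
    (ha : (a : ℂ) ∈ SpectralPollution.resolventSet A)
    (hb : (b : ℂ) ∈ SpectralPollution.resolventSet A)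
    (hess : ∀ x ∈ Set.Icc a b, (x : ℂ) ∉ SpectralPollution.essentialSpectrum A)
    (L : ℕ → Submodule ℂ H) (hL : SpectralPollution.IsTrialSequence A L) :
    SpectralPollution.PollutionOccurs A L a b ↔
      ∃ φ : ℕ → ℕ, StrictMono φ ∧ ∀ j,
        Module.finrank ℂ (SpectralPollution.spectralSubspace A a b) <
          Module.finrank ℂ (SpectralPollution.galerkinSubspace A (L (φ j)) a b) := by
  have hfd := hL.finiteDimensional
  have hfdM := SpectralPollution.finiteDimensional_spectralSubspace hess
  have (n : ℕ) : FiniteDimensional ℂ (SpectralPollution.galerkinSubspace A (L n) a b) :=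
    Submodule.finiteDimensional_of_le (SpectralPollution.galerkinSubspace_le A (L n) a b)
  constructor
  · intro hpol
    by_contra hno
    refine hpol ?_
    have hev : ∀ᶠ n in atTop, Module.finrank ℂ (SpectralPollution.galerkinSubspace A (L n) a b) ≤
        Module.finrank ℂ (SpectralPollution.spectralSubspace A a b) := by
      by_contra hfreq
      rw [not_eventually] at hfreq
      obtain ⟨φ, hφ, h⟩ := extraction_of_frequently_atTop hfreq
      exact hno ⟨φ, hφ, fun j => not_le.1 (h j)⟩
    let f := stdOrthonormalBasis ℂ (SpectralPollution.spectralSubspace A a b)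
    have hlim : Tendsto (fun n => √(∑ i, Metric.infDist (f i : H)
        (SpectralPollution.galerkinSubspace A (L n) a b : Set H) ^ 2)) atTop (𝓝 0) := by
      have h1 := (tendsto_finsetSum Finset.univ fun i _ =>
        (SpectralPollution.tendsto_infDist_galerkinSubspace hA hsb ha hb hL (f i).2).pow 2).sqrt
      simpa using h1
    exact squeeze_zero' (Eventually.of_forall fun n => SpectralPollution.gap_nonneg _ _)
      (hev.mono fun n hn => SpectralPollution.gap_le_sqrt_sum hn f) hlim
  · rintro ⟨φ, hφ, h⟩ hlim
    have h1 : (1 : ℝ) ≤ 0 := ge_of_tendsto' (hlim.comp hφ.tendsto_atTop) fun j =>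
      SpectralPollution.one_le_gap (h j)
    exact absurd h1 (by norm_num)
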